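/- Let $n\ge 0$ be an integer and let $s$ be a real number with $0<s<n+1$; assume moreover that $s>1$ or that $n$ is odd. Let $\delta>s$ and let $\varphi$ be a complex-valued function that is analytic on the half-plane $H(\delta)=\{z\in\mathbb{C}:\Re z\ge-\delta\}$ and for which there are real constants $C$, $P$ and $A<\pi$ with $$\left|\frac{\varphi(v+iw)}{\Gamma(v+iw+1)}\right|\le C\,e^{Pv+A|w|}\qquad\text{for all } v+iw\in H(\delta)$$ (where $1/\Gamma$ is read as an entire function). Let $f:(0,\infty)\to\mathbb{C}$ be the real-analytic function given by $$f(x)=\sum_{k=0}^{\infty}\varphi(k)\frac{(-1)^k}{k!}x^k ,$$ that is, $f$ is real-analytic on $(0,\infty)$ and is equal to the sum of this series for all sufficiently small $x>0$ (so $f$ is the sum of the series on all of $(0,\infty)$ if the series converges everywhere, and its analytic continuation otherwise). Then the improper integral $$\phi(n,s)=\int_0^\infty\frac{\sin^n t}{t^s}\,dt$$ converges; for every $t>0$ the integral over $x$ below converges absolutely; the integral over $t$ converges as an improper integral; and $$\int_0^\infty\left(\int_0^\infty x^{s-1}\sin^n t\; f(xt)\,dx\right)dt=\Gamma(s)\,\varphi(-s)\,\phi(n,s).$$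 Here an improper integral $\int_0^\infty g(t)\,dt$ means $\lim\int_a^b g(t)\,dt$ as $a\to0^+$ and $b\to\infty$. -/

import Mathlib

open Set Filter Topology MeasureTheory

/-- The closed half-plane `H(δ) = {z : Re z ≥ -δ}`. -/
def halfPlane (δ : ℝ) : Set ℂ := {z : ℂ | -δ ≤ z.re}

/-- The Hardy class of coefficient functions for Ramanujan's Master Theorem in its
gamma-function form: `φ` is analytic on `H(δ)`, and `z ↦ φ(z) / Γ(z + 1)` satisfies
`|φ(v + iw) / Γ(v + iw + 1)| ≤ C e^{P v + A |w|}` there, for some constants `C`, `P` and some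
`A < π`.  (Mathlib puts `Γ = 0` at the poles of `Γ`, so the expression `(Γ (z + 1))⁻¹` is the
entire function `1 / Γ(z + 1)`, also at those points.) -/
def HardyClass (δ : ℝ) (φ : ℂ → ℂ) : Prop :=
  AnalyticOnNhd ℂ φ (halfPlane δ) ∧
    ∃ C P A : ℝ, A < Real.pi ∧
      ∀ z ∈ halfPlane δ,
        ‖φ z * (Complex.Gamma (z + 1))⁻¹‖ ≤ C * Real.exp (P * z.re + A * |z.im|)

/-- `f` is the function on `(0, ∞)` given by the series `∑ φ(k) (-1)^k / k! x^k`: it is equal to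
the sum of the series for all sufficiently small `x > 0`, and is the real-analytic
continuation of that sum to all of `(0, ∞)`.  (If the series converges for every `x`,
then `f` is its sum on `(0, ∞)`.) -/
def IsMasterSeries (φ : ℂ → ℂ) (f : ℝ → ℂ) : Prop :=
  AnalyticOnNhd ℝ f (Ioi 0) ∧
    ∀ᶠ x : ℝ in 𝓝[>] 0,
      HasSum (fun k : ℕ => φ (k : ℂ) * (-1) ^ k / (k.factorial : ℂ) * (x : ℂ) ^ k) (f x)

/-- The improper integral `∫_0^∞ g(t) dt` converges, with value `L`: `g` is integrable on
each compact subinterval `[a, b]` of `(0, ∞)`, and `∫_a^b g → L` as `a → 0+` and `b → ∞`. -/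
def HasImproperIntegral {E : Type*} [NormedAddCommGroup E] [NormedSpace ℝ E]
    (g : ℝ → E) (L : E) : Prop :=
  (∀ a b : ℝ, 0 < a → a ≤ b → IntervalIntegrable g volume a b) ∧
    Tendsto (fun p : ℝ × ℝ => ∫ t in p.1..p.2, g t) (𝓝[>] (0 : ℝ) ×ˢ atTop) (𝓝 L)

/-!
Put `G(z) = Γ(z) φ(-z)`.  The substitution `x ↦ x / t` turns the inner integral into
`sin ^ n t * t ^ (-s)` times the Mellin transform of `f` at `s`, so the theorem is Ramanujan's
Master Theorem, `∫_0^∞ x ^ (s - 1) f(x) dx = G(s)` with absolute convergence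
(`IsMasterSeries.hasMellin`), together with the convergence of `∫_0^∞ sin ^ n t / t ^ s dt`
(`exists_hasImproperIntegral_sin_pow_div_rpow`).

*The Master Theorem.*  By the reflection formula, `G(z) = Ψ(z) π / sin (π z)` where
`Ψ(z) = φ(-z) / Γ(1 - z)` is holomorphic for `Re z ≤ δ` and grows at most like
`exp (A |Im z|)` with `A < π`.  As `π / sin (π z)` decays like `exp (-π |Im z|)`, the function `G`
decays exponentially on vertical lines.  In `0 < Re z ≤ δ` it has no poles, and so the inverse
Mellin integral `(2π)⁻¹ ∫ x ^ (-z) G(z)` along `Re z = c` does not depend on `c ∈ (0, δ]`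
(`mellinInv_masterMellin_eq`).  Moving the line to the left across `0, -1, -2, …` collects the
terms of the series of `f` as residues (`mellinInv_masterMellin_sub`), and on
`Re z = -(n + 1/2)` the integral is `O((e ^ P x) ^ (n + 1/2))`, which tends to `0` for small `x`.
Hence the inverse Mellin integral is equal to `f` for small `x`; it is real-analytic on `(0, ∞)`
(`analyticOnNhd_mellinInv`), so it is equal to `f` throughout (`IsMasterSeries.eq_mellinInv`).
Each `c ∈ (0, δ]` thus gives `f(x) = O(x ^ (-c))` on `(0, ∞)`; taking `c` on either side of `s`
gives absolute convergence of the Mellin integral, and Fourier inversion its value.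

*The sine integral.*  At `0` the integrand is at most `t ^ (n - s)` with `n - s > -1`.  At `∞` it is
absolutely integrable if `s > 1`; for odd `n` the function `sin ^ n` has a bounded primitive, and
integration by parts applies.
-/

open Complex (I)
open scoped Real

/-! ### Integrals along vertical lines -/

lemma integrable_exp_neg_mul_abs {η : ℝ} (hη : 0 < η) :
    Integrable (fun y : ℝ => Real.exp (-(η * |y|))) := by
  rw [← integrableOn_univ, ← Iic_union_Ioi (a := (0 : ℝ)), integrableOn_union]
  constructor
  · refine (integrableOn_exp_mul_Iic hη 0).congr_fun (fun y hy => ?_) measurableSet_Iic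
    simp [abs_of_nonpos (mem_Iic.1 hy)]
  · refine (exp_neg_integrableOn_Ioi 0 hη).congr_fun (fun y hy => ?_) measurableSet_Ioi
    simp [abs_of_pos (mem_Ioi.1 hy)]

/-- For a continuous function, exponential decay away from `[-1, 1]` is exponential decay on the
whole line, with a larger constant. -/
lemma exists_forall_norm_le_exp_neg_mul_abs {g : ℝ → ℂ} (hg : Continuous g) {K η : ℝ}
    (h : ∀ y, 1 ≤ |y| → ‖g y‖ ≤ K * Real.exp (-(η * |y|))) :
    ∃ K', 0 ≤ K' ∧ ∀ y, ‖g y‖ ≤ K' * Real.exp (-(η * |y|)) := by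
  obtain ⟨M, hM⟩ := (isCompact_Icc (a := (-1 : ℝ)) (b := 1)).exists_bound_of_continuousOn
    (f := fun y => ‖g y‖ * Real.exp (η * |y|)) (by fun_prop)
  refine ⟨max 0 (max M K), le_max_left _ _, fun y => ?_⟩
  rcases le_total 1 |y| with hy | hy
  · refine (h y hy).trans ?_
    gcongr
    exact (le_max_right _ _).trans (le_max_right _ _)
  · have h1 := (le_abs_self _).trans (hM y (abs_le.1 hy))
    rw [Real.exp_neg, ← div_eq_mul_inv, le_div_iff₀ (Real.exp_pos _)]
    exact h1.trans ((le_max_left _ _).trans (le_max_right _ _))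

lemma integrable_of_exp_decay {g : ℝ → ℂ} (hg : Continuous g) {K η : ℝ} (hη : 0 < η)
    (h : ∀ y, 1 ≤ |y| → ‖g y‖ ≤ K * Real.exp (-(η * |y|))) : Integrable g := by
  obtain ⟨K', -, hK'⟩ := exists_forall_norm_le_exp_neg_mul_abs hg h
  exact ((integrable_exp_neg_mul_abs hη).const_mul K').mono' hg.aestronglyMeasurable
    (Eventually.of_forall hK')

lemma continuous_comp_vertical {g : ℂ → ℂ} {a b c : ℝ}
    (hg : ContinuousOn g {z | a ≤ z.re ∧ z.re ≤ b}) (hac : a ≤ c) (hcb : c ≤ b) :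
    Continuous fun y : ℝ => g (c + y * I) :=
  hg.comp_continuous (by fun_prop) fun y => by simp [hac, hcb]

/-- Shift of a vertical line of integration over a strip without poles.  The exceptional set `S`,
where only continuity is required, leaves room for removable singularities. -/
theorem integral_vertical_eq_of_exp_decay {g : ℂ → ℂ} {a b K η : ℝ} (hab : a ≤ b) (hη : 0 < η)
    {S : Set ℂ} (hS : S.Countable) (hc : ContinuousOn g {z | a ≤ z.re ∧ z.re ≤ b})
    (hd : ∀ z, a < z.re → z.re < b → z ∉ S → DifferentiableAt ℂ g z)
    (hK : ∀ z, a ≤ z.re → z.re ≤ b → 1 ≤ |z.im| → ‖g z‖ ≤ K * Real.exp (-(η * |z.im|))) :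
    ∫ y : ℝ, g (a + y * I) = ∫ y : ℝ, g (b + y * I) := by
  have key : ∀ c, a ≤ c → c ≤ b → Tendsto (fun T : ℝ => ∫ y in (-T)..T, g (c + y * I)) atTop
      (𝓝 (∫ y : ℝ, g (c + y * I))) := fun c h1 h2 =>
    intervalIntegral_tendsto_integral
      (integrable_of_exp_decay (K := K) (continuous_comp_vertical hc h1 h2) hη
        fun y hy => by simpa using hK (c + y * I) (by simpa) (by simpa) (by simpa))
      tendsto_neg_atTop_atBot tendsto_id
  have hsub := (key b hab le_rfl).sub (key a le_rfl hab)
  have h0 : Tendsto (fun T : ℝ => (∫ y in (-T)..T, g (b + y * I)) - ∫ y in (-T)..T, g (a + y * I))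
      atTop (𝓝 0) := by
    have hlim : Tendsto (fun T : ℝ => 2 * (K * Real.exp (-(η * T)) * |b - a|)) atTop (𝓝 0) := by
      have : Tendsto (fun T : ℝ => Real.exp (-(η * T))) atTop (𝓝 0) :=
        Real.tendsto_exp_neg_atTop_nhds_zero.comp (tendsto_id.const_mul_atTop hη)
      simpa using ((this.const_mul K).mul_const |b - a|).const_mul 2
    refine squeeze_zero_norm' ?_ hlim
    filter_upwards [eventually_ge_atTop 1] with T hT
    have hT0 : (0 : ℝ) ≤ T := by linarith
    have hrect := Complex.integral_boundary_rect_eq_zero_of_differentiable_on_off_countable g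
      (a + ((-T : ℝ) : ℂ) * I) (b + (T : ℂ) * I) S hS
      (hc.mono fun z hz => by
        simp only [Complex.mem_reProdIm, Complex.add_re, Complex.ofReal_re, Complex.mul_re,
          Complex.I_re, Complex.I_im, Complex.ofReal_im, mul_zero, mul_one, sub_self, add_zero,
          uIcc_of_le hab] at hz
        exact hz.1)
      (fun z hz => by
        have h := hz.1
        simp only [Complex.mem_reProdIm, Complex.add_re, Complex.ofReal_re, Complex.mul_re,
          Complex.I_re, Complex.I_im, Complex.ofReal_im, mul_zero, mul_one, sub_self, add_zero,
          min_eq_left hab, max_eq_right hab] at h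
        exact hd z h.1.1 h.1.2 hz.2)
    simp only [Complex.add_re, Complex.ofReal_re, Complex.mul_re, Complex.I_re, Complex.I_im,
      Complex.ofReal_im, mul_zero, mul_one, sub_self, add_zero, Complex.add_im, Complex.mul_im,
      zero_add] at hrect
    have hh : ∀ τ : ℝ, |τ| = T → ‖∫ x in a..b, g (x + τ * I)‖ ≤
        K * Real.exp (-(η * T)) * |b - a| := fun τ hτ =>
      intervalIntegral.norm_integral_le_of_norm_le_const fun x hx => by
        rw [uIoc_of_le hab] at hx
        simpa [hτ] using hK (x + τ * I) (by simpa using hx.1.le) (by simpa using hx.2)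
          (by simpa [hτ] using hT)
    have e : I • ((∫ y in (-T)..T, g (b + y * I)) - ∫ y in (-T)..T, g (a + y * I)) =
        (∫ x in a..b, g (x + (T : ℝ) * I)) - ∫ x in a..b, g (x + ((-T : ℝ) : ℂ) * I) := by
      rw [smul_sub]; linear_combination hrect
    calc _ = ‖I • ((∫ y in (-T)..T, g (b + y * I)) - ∫ y in (-T)..T, g (a + y * I))‖ := by
          simp
      _ ≤ _ := by
          rw [e, two_mul]
          exact (norm_sub_le _ _).trans (add_le_add (hh T (abs_of_nonneg hT0))
            (hh (-T) (by rw [abs_neg, abs_of_nonneg hT0])))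
  exact (sub_eq_zero.1 (tendsto_nhds_unique hsub h0)).symm

/-! ### The kernel `π / sin (π z)` -/

lemma Complex.cos_int_mul_pi_eq (k : ℤ) : Complex.cos (k * π) = (-1) ^ k := by
  have h := congrArg (fun x : ℝ => (x : ℂ)) (Real.cos_int_mul_pi k)
  push_cast at h
  exact h

lemma Complex.sin_add_int_mul_pi_eq (z : ℂ) (k : ℤ) :
    Complex.sin (z + k * π) = (-1) ^ k * Complex.sin z := by
  rw [Complex.sin_add, Complex.cos_int_mul_pi_eq, Complex.sin_int_mul_pi]
  ring

lemma norm_sin_sq (z : ℂ) : ‖Complex.sin z‖ ^ 2 = Real.sin z.re ^ 2 + Real.sinh z.im ^ 2 := by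
  rw [Complex.sin_eq, ← Complex.normSq_eq_norm_sq]
  have : Complex.sin z.re * Complex.cosh z.im + Complex.cos z.re * Complex.sinh z.im * I =
      ((Real.sin z.re * Real.cosh z.im : ℝ) : ℂ) + ((Real.cos z.re * Real.sinh z.im : ℝ) : ℂ) * I := by
    push_cast; ring
  rw [this, Complex.normSq_add_mul_I]
  have h1 := Real.cosh_sq z.im
  have h2 := Real.sin_sq_add_cos_sq z.re
  linear_combination Real.sin z.re ^ 2 * h1 + Real.sinh z.im ^ 2 * h2

lemma norm_pi_div_sin_le {z : ℂ} (hz : 1 ≤ |z.im|) :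
    ‖(π : ℂ) / Complex.sin (π * z)‖ ≤ 4 * π * Real.exp (-(π * |z.im|)) := by
  have him : (π * z : ℂ).im = π * z.im := by simp
  have h1 : Real.exp (π * |z.im|) / 4 ≤ Real.sinh (π * |z.im|) := by
    have h3 : (1 : ℝ) ≤ π * |z.im| := by nlinarith [Real.pi_gt_three]
    have h4 : Real.exp (-(π * |z.im|)) ≤ 1 := Real.exp_le_one_iff.2 (by linarith)
    have h5 : 2 ≤ Real.exp (π * |z.im|) := by linarith [Real.add_one_le_exp (π * |z.im|)]
    rw [Real.sinh_eq]; linarith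
  have h2 : Real.sinh (π * |z.im|) ≤ ‖Complex.sin (π * z)‖ := by
    refine le_of_sq_le_sq ?_ (norm_nonneg _)
    rw [norm_sin_sq, him, ← sq_abs (Real.sinh (π * z.im)), Real.abs_sinh, abs_mul,
      abs_of_pos Real.pi_pos]
    nlinarith [sq_nonneg (Real.sin (π * z : ℂ).re)]
  have h3 := h1.trans h2
  rw [norm_div, Complex.norm_real, Real.norm_of_nonneg Real.pi_pos.le, Real.exp_neg,
    div_le_iff₀ (by linarith [Real.exp_pos (π * |z.im|)])]
  calc π = 4 * π * (Real.exp (π * |z.im|))⁻¹ * (Real.exp (π * |z.im|) / 4) := by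
        field_simp
    _ ≤ _ := by gcongr

/-- On the lines `Re z ∈ ℤ + 1/2` the kernel decays exponentially without restriction on `Im z`. -/
lemma norm_pi_div_sin_le_of_cos_eq_zero {z : ℂ} (hz : Real.cos (π * z.re) = 0) :
    ‖(π : ℂ) / Complex.sin (π * z)‖ ≤ 2 * π * Real.exp (-(π * |z.im|)) := by
  have him : (π * z : ℂ).im = π * z.im := by simp
  have hre : (π * z : ℂ).re = π * z.re := by simp
  have h1 : Real.exp (π * |z.im|) / 2 ≤ Real.cosh (π * |z.im|) := by
    rw [Real.cosh_eq]; linarith [Real.exp_pos (-(π * |z.im|))]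
  have h2 : Real.cosh (π * |z.im|) ≤ ‖Complex.sin (π * z)‖ := by
    refine le_of_sq_le_sq ?_ (norm_nonneg _)
    rw [norm_sin_sq, him, hre, ← sq_abs (Real.sinh (π * z.im)), Real.abs_sinh, abs_mul,
      abs_of_pos Real.pi_pos, Real.cosh_sq, Real.sin_sq, hz]
    linarith
  have h3 := h1.trans h2
  rw [norm_div, Complex.norm_real, Real.norm_of_nonneg Real.pi_pos.le, Real.exp_neg,
    div_le_iff₀ (by linarith [Real.exp_pos (π * |z.im|)])]
  calc π = 2 * π * (Real.exp (π * |z.im|))⁻¹ * (Real.exp (π * |z.im|) / 2) := by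
        field_simp
    _ ≤ _ := by gcongr

lemma sin_pi_mul_ne_zero_of_lt_of_lt {z : ℂ} (k : ℤ) (h1 : k < z.re) (h2 : z.re < k + 1) :
    Complex.sin (π * z) ≠ 0 := by
  rw [Ne, Complex.sin_eq_zero_iff]
  rintro ⟨m, hm⟩
  have hz : z = m := mul_left_cancel₀ (Complex.ofReal_ne_zero.2 Real.pi_ne_zero)
    (by rw [hm]; ring)
  subst hz
  simp only [Complex.intCast_re] at h1 h2
  have h1' : k < m := by exact_mod_cast h1
  have h2' : m < k + 1 := by exact_mod_cast h2
  omega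

/-- On `Re z = 1/2` the kernel is `π / cosh (π y)`, with primitive `2 arctan (exp (π y))`. -/
lemma integral_pi_div_sin_half :
    ∫ y : ℝ, (π : ℂ) / Complex.sin (π * ((1 / 2 : ℝ) + y * I)) = π := by
  have e : ∀ y : ℝ, (π : ℂ) / Complex.sin (π * ((1 / 2 : ℝ) + y * I)) =
      ((π / Real.cosh (π * y) : ℝ) : ℂ) := fun y => by
    have : (π : ℂ) * ((1 / 2 : ℝ) + y * I) = (π * y) * I + π / 2 := by push_cast; ring
    rw [this, Complex.sin_add_pi_div_two, Complex.cos_mul_I]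
    push_cast; rfl
  simp_rw [e]
  have hd : ∀ y : ℝ, HasDerivAt (fun y : ℝ => 2 * Real.arctan (Real.exp (π * y)))
      (π / Real.cosh (π * y)) y := fun y => by
    have h := (((hasDerivAt_id y).const_mul π).exp.arctan).const_mul 2
    convert! h using 1
    simp only [id, Real.cosh_eq, Real.exp_neg]
    have := Real.exp_pos (π * y)
    field_simp
    ring
  have hi : Integrable fun y : ℝ => π / Real.cosh (π * y) := by
    refine ((integrable_exp_neg_mul_abs Real.pi_pos).const_mul (2 * π)).mono'
      (Continuous.aestronglyMeasurable
        (continuous_const.div (by fun_prop) fun y => (Real.cosh_pos _).ne')) ?_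
    refine Eventually.of_forall fun y => ?_
    have h := norm_pi_div_sin_le_of_cos_eq_zero (z := (1 / 2 : ℝ) + y * I) (by simp [← div_eq_mul_inv])
    rw [e, Complex.norm_real] at h
    simpa using h
  rw [integral_complex_ofReal, integral_of_hasDerivAt_of_tendsto hd hi (m := 0) (n := π)]
  · simp
  · have h1 : Tendsto (fun y : ℝ => Real.exp (π * y)) atBot (𝓝 0) :=
      Real.tendsto_exp_atBot.comp (tendsto_id.const_mul_atBot Real.pi_pos)
    simpa using ((Real.continuous_arctan.tendsto 0).comp h1).const_mul 2
  · have h1 : Tendsto (fun y : ℝ => Real.exp (π * y)) atTop atTop :=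
      Real.tendsto_exp_atTop.comp (tendsto_id.const_mul_atTop Real.pi_pos)
    have := ((Real.tendsto_arctan_atTop.mono_right nhdsWithin_le_nhds).comp h1).const_mul 2
    simpa [mul_div_cancel₀] using this

lemma differentiableAt_pi_div_sin {z : ℂ} (hz : Complex.sin (π * z) ≠ 0) :
    DifferentiableAt ℂ (fun z : ℂ => (π : ℂ) / Complex.sin (π * z)) z :=
  (differentiableAt_const _).div (by fun_prop) hz

lemma integral_pi_div_sin {k : ℤ} {c : ℝ} (h1 : k < c) (h2 : c < k + 1) :
    ∫ y : ℝ, (π : ℂ) / Complex.sin (π * (c + y * I)) = (-1) ^ k * π := by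
  have main : ∀ a b : ℝ, 0 < a → b < 1 → a ≤ b →
      ∫ y : ℝ, (π : ℂ) / Complex.sin (π * (a + y * I)) =
      ∫ y : ℝ, (π : ℂ) / Complex.sin (π * (b + y * I)) := fun a b ha hb hab => by
    have hd : ∀ z : ℂ, a ≤ z.re → z.re ≤ b →
        DifferentiableAt ℂ (fun z : ℂ => (π : ℂ) / Complex.sin (π * z)) z := fun z h h' =>
      differentiableAt_pi_div_sin (sin_pi_mul_ne_zero_of_lt_of_lt 0 (by simpa using ha.trans_le h)
        (by simpa using h'.trans_lt hb))
    exact integral_vertical_eq_of_exp_decay (g := fun z => (π : ℂ) / Complex.sin (π * z)) hab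
      Real.pi_pos countable_empty (fun z hz => (hd z hz.1 hz.2).continuousAt.continuousWithinAt)
      (fun z h h' _ => hd z h.le h'.le) fun z _ _ h => norm_pi_div_sin_le h
  have e : ∀ y : ℝ, (π : ℂ) / Complex.sin (π * (c + y * I)) =
      (-1) ^ k * (π / Complex.sin (π * ((c - k : ℝ) + y * I))) := fun y => by
    have : (π : ℂ) * (c + y * I) = π * ((c - k : ℝ) + y * I) + k * π := by push_cast; ring
    rw [this, Complex.sin_add_int_mul_pi_eq]
    rcases Int.even_or_odd k with h | h <;> simp [h.neg_one_zpow, div_neg]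
  simp_rw [e]
  rw [integral_const_mul]
  congr 1
  refine Eq.trans ?_ integral_pi_div_sin_half
  rcases le_total (c - k) (1 / 2) with h | h
  · exact main _ _ (by linarith) (by norm_num) h
  · exact (main _ _ (by norm_num) (by linarith) h).symm

/-- The residue theorem for `q(z) π / sin (π z)` on a vertical strip around the integer `k`.  The
difference `(q(z) - q(k)) π / sin (π z)` has a removable singularity at `k`, so its integral does
not change from one line to the other; the integrals of the kernel itself are known explicitly. -/
theorem integral_vertical_sub_integral_vertical {k : ℤ} {a b C A : ℝ} (ha : k - 1 < a) (ha' : a < k)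
    (hb : k < b) (hb' : b < k + 1) {q : ℂ → ℂ}
    (hq : ∀ z : ℂ, a ≤ z.re → z.re ≤ b → DifferentiableAt ℂ q z) (hA0 : 0 ≤ A) (hA : A < π)
    (hbd : ∀ z : ℂ, a ≤ z.re → z.re ≤ b → ‖q z‖ ≤ C * Real.exp (A * |z.im|)) :
    (∫ y : ℝ, q (b + y * I) * (π / Complex.sin (π * (b + y * I)))) -
      ∫ y : ℝ, q (a + y * I) * (π / Complex.sin (π * (a + y * I))) =
      2 * π * ((-1) ^ k * q k) := by
  have hη : 0 < π - A := by linarith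
  have hpi : (π : ℂ) ≠ 0 := Complex.ofReal_ne_zero.2 Real.pi_ne_zero
  have hk1 : a ≤ (k : ℂ).re := by simpa using ha'.le
  have hk2 : (k : ℂ).re ≤ b := by simpa using hb.le
  let S : ℂ → ℂ := fun z => Complex.sin (π * z) / π
  have hS : Differentiable ℂ S := by fun_prop
  have hSk : S k = 0 := by
    simp only [S]
    rw [mul_comm, Complex.sin_int_mul_pi, zero_div]
  have hSd : deriv S k ≠ 0 := by
    have h1 : HasDerivAt S (Complex.cos (π * k)) k := by
      have := (((hasDerivAt_id (k : ℂ)).const_mul (π : ℂ)).csin).div_const (π : ℂ)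
      convert! this using 1
      simp [hpi]
    rw [h1.deriv, mul_comm, Complex.cos_int_mul_pi_eq]
    exact zpow_ne_zero _ (by norm_num)
  have hsin : ∀ z : ℂ, a ≤ z.re → z.re ≤ b → z ≠ k → Complex.sin (π * z) ≠ 0 := by
    intro z h1 h2 hz h0
    obtain ⟨m, hm⟩ := Complex.sin_eq_zero_iff.1 h0
    have hzm : z = m := mul_left_cancel₀ hpi (by rw [hm]; ring)
    rw [hzm, Complex.intCast_re] at h1 h2
    have h3 : k - 1 < m := by exact_mod_cast ha.trans_le h1
    have h4 : m < k + 1 := by exact_mod_cast h2.trans_lt hb'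
    exact hz (by rw [hzm, show m = k by omega])
  -- the quotient of the difference quotients of `q` and `sin (π z) / π` at `k` extends
  -- `(q z - q k) * (π / sin (π z))` continuously over the pole
  let g : ℂ → ℂ := fun z => dslope q k z / dslope S k z
  have hg : ∀ z : ℂ, z ≠ k → g z = q z * (π / Complex.sin (π * z)) -
      q k * (π / Complex.sin (π * z)) := by
    intro z hz
    have hz' : z - k ≠ 0 := sub_ne_zero.2 hz
    simp only [g, dslope_of_ne _ hz, slope_def_field, hSk, sub_zero]
    rw [div_div_div_cancel_right₀ hz']
    simp only [S]
    rw [div_div_eq_mul_div]; ring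
  have hDS : ∀ z : ℂ, a ≤ z.re → z.re ≤ b → dslope S k z ≠ 0 := by
    intro z h1 h2
    by_cases hz : z = k
    · rw [hz, dslope_same]; exact hSd
    · rw [dslope_of_ne _ hz, slope_def_field, hSk, sub_zero]
      exact div_ne_zero (div_ne_zero (hsin z h1 h2 hz) hpi) (sub_ne_zero.2 hz)
  have hdc : ∀ (r : ℂ → ℂ), DifferentiableAt ℂ r k → ∀ z, DifferentiableAt ℂ r z →
      ContinuousAt (dslope r k) z := by
    intro r hr z hz
    by_cases h : z = k
    · rw [h]; exact continuousAt_dslope_same.2 hr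
    · exact (continuousAt_dslope_of_ne h).2 hz.continuousAt
  have hgc : ContinuousOn g {z | a ≤ z.re ∧ z.re ≤ b} := fun z hz =>
    ((hdc q (hq k hk1 hk2) z (hq z hz.1 hz.2)).div (hdc S (hS k) z (hS z))
      (hDS z hz.1 hz.2)).continuousWithinAt
  have hC : 0 ≤ C := by
    have := (norm_nonneg _).trans (hbd k hk1 hk2)
    exact nonneg_of_mul_nonneg_left this (Real.exp_pos _)
  have hqK : ∀ z : ℂ, a ≤ z.re → z.re ≤ b → 1 ≤ |z.im| →
      ‖q z * (π / Complex.sin (π * z))‖ ≤ C * (4 * π) * Real.exp (-((π - A) * |z.im|)) := by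
    intro z h1 h2 h3
    rw [norm_mul]
    calc _ ≤ C * Real.exp (A * |z.im|) * (4 * π * Real.exp (-(π * |z.im|))) :=
          mul_le_mul (hbd z h1 h2) (norm_pi_div_sin_le h3) (norm_nonneg _) (by positivity)
      _ = C * (4 * π) * (Real.exp (A * |z.im|) * Real.exp (-(π * |z.im|))) := by ring
      _ = _ := by rw [← Real.exp_add]; ring_nf
  have hkK : ∀ z : ℂ, 1 ≤ |z.im| →
      ‖q k * (π / Complex.sin (π * z))‖ ≤ ‖q k‖ * (4 * π) * Real.exp (-((π - A) * |z.im|)) := by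
    intro z h3
    rw [norm_mul, mul_assoc]
    gcongr
    refine (norm_pi_div_sin_le h3).trans ?_
    gcongr
    nlinarith [abs_nonneg z.im]
  have hshift := integral_vertical_eq_of_exp_decay (g := g) (ha'.trans hb).le hη
    (countable_singleton (k : ℂ)) hgc
    (K := C * (4 * π) + ‖q k‖ * (4 * π))
    (fun z h1 h2 hz => by
      have hz : z ≠ k := hz
      exact ((differentiableAt_dslope_of_ne hz).2 (hq z h1.le h2.le)).div
        ((differentiableAt_dslope_of_ne hz).2 (hS z)) (hDS z h1.le h2.le))
    (fun z h1 h2 h3 => by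
      have hz : z ≠ k := by
        rintro rfl
        simp at h3
        linarith
      rw [hg z hz, add_mul]
      exact (norm_sub_le _ _).trans (add_le_add (hqK z h1 h2 h3) (hkK z h3)))
  have hline : ∀ c : ℝ, a ≤ c → c ≤ b → c ≠ k → ∫ y : ℝ, g (c + y * I) =
      (∫ y : ℝ, q (c + y * I) * (π / Complex.sin (π * (c + y * I)))) -
        q k * ∫ y : ℝ, (π / Complex.sin (π * (c + y * I))) := by
    intro c h1 h2 hck
    have hne : ∀ y : ℝ, (c + y * I : ℂ) ≠ k := fun y h => hck (by simpa using congrArg Complex.re h)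
    have hs : ∀ y : ℝ, Complex.sin (π * (c + y * I)) ≠ 0 := fun y =>
      hsin _ (by simpa) (by simpa) (hne y)
    have hcs : Continuous fun y : ℝ => (π : ℂ) / Complex.sin (π * (c + y * I)) :=
      continuous_const.div (by fun_prop) hs
    have hcq : Continuous fun y : ℝ => q (c + y * I) :=
      continuous_comp_vertical (fun z hz => (hq z hz.1 hz.2).continuousAt.continuousWithinAt) h1 h2
    rw [← integral_const_mul, ← integral_sub]
    · exact integral_congr_ae (Eventually.of_forall fun y => hg _ (hne y))
    · exact integrable_of_exp_decay (hcq.mul hcs) hη fun y hy => by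
        simpa using hqK (c + y * I) (by simpa) (by simpa) (by simpa)
    · exact integrable_of_exp_decay (hcs.const_mul _) hη fun y hy => by
        simpa using hkK (c + y * I) (by simpa)
  rw [hline a le_rfl (ha'.trans hb).le ha'.ne, hline b (ha'.trans hb).le le_rfl hb.ne',
    integral_pi_div_sin hb hb', integral_pi_div_sin (k := k - 1) (by push_cast; linarith)
      (by push_cast; linarith), zpow_sub_one₀ (by norm_num)] at hshift
  linear_combination (-1) * hshift

/-! ### The function `Γ(z) φ(-z)` in the Hardy class -/

/-- The function `Γ(z) φ(-z)`, which is the Mellin transform of the master series of `φ` in the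
strip `0 < Re z < δ` (see `IsMasterSeries.hasMellin`). -/
noncomputable def masterMellin (φ : ℂ → ℂ) (z : ℂ) : ℂ := Complex.Gamma z * φ (-z)

/-- The quotient `φ(-z) / Γ(1 - z)`, which the Hardy class controls for `Re z ≤ δ`.  As in
`HardyClass`, the junk value `Γ = 0` at the poles of `Γ` makes `(Γ (-z + 1))⁻¹` entire. -/
noncomputable def hardyQuotient (φ : ℂ → ℂ) (z : ℂ) : ℂ := φ (-z) * (Complex.Gamma (-z + 1))⁻¹

/-- The Hardy bound in terms of `hardyQuotient`, with the growth exponent `A` made nonnegative. -/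
lemma HardyClass.exists_bound {δ : ℝ} {φ : ℂ → ℂ} (hφ : HardyClass δ φ) :
    ∃ C P A : ℝ, 0 ≤ C ∧ 0 ≤ A ∧ A < π ∧ ∀ z : ℂ, z.re ≤ δ →
      ‖hardyQuotient φ z‖ ≤ C * Real.exp (-(P * z.re)) * Real.exp (A * |z.im|) := by
  obtain ⟨-, C, P, A, hA, h⟩ := hφ
  have hC : 0 ≤ C := by
    have := (norm_nonneg _).trans (h (-δ : ℝ) (by simp [halfPlane]))
    exact nonneg_of_mul_nonneg_left this (Real.exp_pos _)
  refine ⟨C, P, max A 0, hC, le_max_right _ _, max_lt hA Real.pi_pos, fun z hz => ?_⟩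
  refine (h (-z) (by simpa [halfPlane] using hz)).trans ?_
  rw [mul_assoc, ← Real.exp_add, Complex.neg_re, Complex.neg_im, abs_neg, mul_neg]
  gcongr
  exact le_max_left _ _

lemma HardyClass.differentiableAt_comp_neg {δ : ℝ} {φ : ℂ → ℂ} (hφ : HardyClass δ φ) {z : ℂ}
    (hz : z.re ≤ δ) : DifferentiableAt ℂ (fun z => φ (-z)) z :=
  DifferentiableAt.comp z (hφ.1 (-z) (by simpa [halfPlane] using hz)).differentiableAt
    differentiableAt_id.neg

lemma HardyClass.differentiableAt_hardyQuotient {δ : ℝ} {φ : ℂ → ℂ} (hφ : HardyClass δ φ) {z : ℂ}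
    (hz : z.re ≤ δ) : DifferentiableAt ℂ (hardyQuotient φ) z :=
  (hφ.differentiableAt_comp_neg hz).mul
    ((Complex.differentiable_one_div_Gamma.comp (differentiable_id.neg.add_const 1)) z)

lemma HardyClass.differentiableAt_masterMellin {δ : ℝ} {φ : ℂ → ℂ} (hφ : HardyClass δ φ) {z : ℂ}
    (hz0 : 0 < z.re) (hz : z.re ≤ δ) : DifferentiableAt ℂ (masterMellin φ) z :=
  (Complex.differentiableAt_Gamma z fun m h => by
    rw [h, Complex.neg_re, Complex.natCast_re] at hz0
    linarith [m.cast_nonneg (α := ℝ)]).mul (hφ.differentiableAt_comp_neg hz)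

lemma masterMellin_eq (φ : ℂ → ℂ) {z : ℂ} (hz : Complex.sin (π * z) ≠ 0) :
    masterMellin φ z = hardyQuotient φ z * (π / Complex.sin (π * z)) := by
  have h := Complex.Gamma_mul_Gamma_one_sub z
  have h1 : Complex.Gamma (1 - z) ≠ 0 := fun h0 => by
    rw [h0, mul_zero] at h
    exact div_ne_zero (Complex.ofReal_ne_zero.2 Real.pi_ne_zero) hz h.symm
  rw [masterMellin, hardyQuotient, ← h, show -z + 1 = 1 - z by ring]
  field_simp

lemma hardyQuotient_neg_natCast (φ : ℂ → ℂ) (n : ℕ) :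
    hardyQuotient φ (-(n : ℂ)) = φ n / (n.factorial : ℂ) := by
  rw [hardyQuotient, neg_neg, Complex.Gamma_nat_eq_factorial, div_eq_mul_inv]

lemma exists_strip_bound {δ : ℝ} {φ : ℂ → ℂ} (hφ : HardyClass δ φ) {x : ℝ} (hx : 0 < x) (a b : ℝ)
    (hb : b ≤ δ) :
    ∃ C A : ℝ, 0 ≤ C ∧ 0 ≤ A ∧ A < π ∧ ∀ z : ℂ, a ≤ z.re → z.re ≤ b →
      ‖(x : ℂ) ^ (-z) * hardyQuotient φ z‖ ≤ C * Real.exp (A * |z.im|) := by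
  obtain ⟨C, P, A, hC, hA0, hA, h⟩ := hφ.exists_bound
  refine ⟨C * Real.exp (|P + Real.log x| * max |a| |b|), A, by positivity, hA0, hA,
    fun z h1 h2 => ?_⟩
  rw [norm_mul, Complex.norm_cpow_eq_rpow_re_of_pos hx, Real.rpow_def_of_pos hx]
  have hz : |z.re| ≤ max |a| |b| := abs_le_max_abs_abs h1 h2
  have he : Real.log x * (-z).re + -(P * z.re) ≤ |P + Real.log x| * max |a| |b| :=
    calc _ = -((P + Real.log x) * z.re) := by rw [Complex.neg_re]; ring
      _ ≤ |(P + Real.log x) * z.re| := neg_le_abs _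
      _ ≤ _ := by rw [abs_mul]; gcongr
  calc _ ≤ Real.exp (Real.log x * (-z).re) *
        (C * Real.exp (-(P * z.re)) * Real.exp (A * |z.im|)) := by
        gcongr; exact h z (h2.trans hb)
    _ = C * Real.exp (Real.log x * (-z).re + -(P * z.re)) * Real.exp (A * |z.im|) := by
        rw [Real.exp_add]; ring
    _ ≤ _ := by gcongr

lemma differentiableAt_const_cpow_neg {x : ℝ} (hx : 0 < x) (z : ℂ) :
    DifferentiableAt ℂ (fun z : ℂ => (x : ℂ) ^ (-z)) z :=
  differentiableAt_id.neg.const_cpow (Or.inl (Complex.ofReal_ne_zero.2 hx.ne'))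

lemma sin_pi_mul_ne_zero_of_im {z : ℂ} (hz : 1 ≤ |z.im|) : Complex.sin (π * z) ≠ 0 := by
  intro h0
  obtain ⟨m, hm⟩ := Complex.sin_eq_zero_iff.1 h0
  have hzm : z = m := mul_left_cancel₀ (Complex.ofReal_ne_zero.2 Real.pi_ne_zero)
    (by rw [hm]; ring)
  rw [hzm, Complex.intCast_im, abs_zero] at hz
  linarith

lemma exists_masterMellin_decay {δ : ℝ} {φ : ℂ → ℂ} (hφ : HardyClass δ φ) {x : ℝ} (hx : 0 < x)
    (a b : ℝ) (hb : b ≤ δ) :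
    ∃ K η : ℝ, 0 < η ∧ ∀ z : ℂ, a ≤ z.re → z.re ≤ b → 1 ≤ |z.im| →
      ‖(x : ℂ) ^ (-z) * masterMellin φ z‖ ≤ K * Real.exp (-(η * |z.im|)) := by
  obtain ⟨C, A, hC, hA0, hA, h⟩ := exists_strip_bound hφ hx a b hb
  refine ⟨C * (4 * π), π - A, by linarith, fun z h1 h2 h3 => ?_⟩
  rw [masterMellin_eq φ (sin_pi_mul_ne_zero_of_im h3), ← mul_assoc, norm_mul]
  calc _ ≤ C * Real.exp (A * |z.im|) * (4 * π * Real.exp (-(π * |z.im|))) :=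
        mul_le_mul (h z h1 h2) (norm_pi_div_sin_le h3) (norm_nonneg _) (by positivity)
    _ = C * (4 * π) * (Real.exp (A * |z.im|) * Real.exp (-(π * |z.im|))) := by ring
    _ = _ := by rw [← Real.exp_add]; ring_nf

/-! ### Inverse Mellin integrals and the series -/

theorem mellinInv_masterMellin_eq_of_le {δ : ℝ} {φ : ℂ → ℂ} (hφ : HardyClass δ φ) {x : ℝ}
    (hx : 0 < x) {a b : ℝ} (ha : 0 < a) (hab : a ≤ b) (hb : b ≤ δ) :
    mellinInv a (masterMellin φ) x = mellinInv b (masterMellin φ) x := by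
  obtain ⟨K, η, hη, h⟩ := exists_masterMellin_decay hφ hx a b hb
  have hd : ∀ z : ℂ, a ≤ z.re → z.re ≤ b →
      DifferentiableAt ℂ (fun z : ℂ => (x : ℂ) ^ (-z) * masterMellin φ z) z := fun z h1 h2 =>
    (differentiableAt_const_cpow_neg hx z).mul
      (hφ.differentiableAt_masterMellin (ha.trans_le h1) (h2.trans hb))
  simp only [mellinInv, smul_eq_mul]
  rw [integral_vertical_eq_of_exp_decay (g := fun z : ℂ => (x : ℂ) ^ (-z) * masterMellin φ z)
    hab hη countable_empty (fun z hz => (hd z hz.1 hz.2).continuousAt.continuousWithinAt)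
    (fun z h1 h2 _ => hd z h1.le h2.le) h]

theorem mellinInv_masterMellin_eq {δ : ℝ} {φ : ℂ → ℂ} (hφ : HardyClass δ φ) {x : ℝ}
    (hx : 0 < x) {a b : ℝ} (ha : a ∈ Ioc 0 δ) (hb : b ∈ Ioc 0 δ) :
    mellinInv a (masterMellin φ) x = mellinInv b (masterMellin φ) x := by
  rcases le_total a b with h | h
  · exact mellinInv_masterMellin_eq_of_le hφ hx ha.1 h hb.2
  · exact (mellinInv_masterMellin_eq_of_le hφ hx hb.1 h ha.2).symm

lemma mellinInv_masterMellin_eq_integral (φ : ℂ → ℂ) {c : ℝ} (k : ℤ) (h1 : k < c) (h2 : c < k + 1)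
    (x : ℝ) : mellinInv c (masterMellin φ) x = (1 / (2 * π)) • ∫ y : ℝ,
      (x : ℂ) ^ (-(c + y * I)) * hardyQuotient φ (c + y * I) *
        (π / Complex.sin (π * (c + y * I))) := by
  rw [mellinInv]
  congr 2
  ext y
  rw [masterMellin_eq φ (sin_pi_mul_ne_zero_of_lt_of_lt k (by simpa) (by simpa)), smul_eq_mul,
    mul_assoc]

/-- Moving the line of integration across the pole of `Γ` at `-n` collects the term of order `n` of
the master series. -/
theorem mellinInv_masterMellin_sub {δ : ℝ} {φ : ℂ → ℂ} (hφ : HardyClass δ φ) {x : ℝ}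
    (hx : 0 < x) (n : ℕ) {a b : ℝ} (ha : -(n : ℝ) - 1 < a) (ha' : a < -(n : ℝ))
    (hb : -(n : ℝ) < b) (hb' : b < -(n : ℝ) + 1) (hbδ : b ≤ δ) :
    mellinInv b (masterMellin φ) x - mellinInv a (masterMellin φ) x =
      φ n * (-1) ^ n / (n.factorial : ℂ) * (x : ℂ) ^ n := by
  obtain ⟨C, A, hC, hA0, hA, h⟩ := exists_strip_bound hφ hx a b hbδ
  have hres := integral_vertical_sub_integral_vertical (k := -(n : ℤ)) (a := a) (b := b)
    (q := fun z => (x : ℂ) ^ (-z) * hardyQuotient φ z)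
    (by simpa) (by simpa) (by simpa) (by push_cast; linarith)
    (fun z _ h2 => (differentiableAt_const_cpow_neg hx z).mul
      (hφ.differentiableAt_hardyQuotient (h2.trans hbδ))) hA0 hA h
  rw [mellinInv_masterMellin_eq_integral φ (-(n : ℤ)) (by simpa) (by push_cast; linarith),
    mellinInv_masterMellin_eq_integral φ (-(n : ℤ) - 1) (by simpa) (by simpa), ← smul_sub, hres]
  have hpi : (π : ℂ) ≠ 0 := Complex.ofReal_ne_zero.2 Real.pi_ne_zero
  push_cast
  rw [hardyQuotient_neg_natCast, neg_neg, Complex.cpow_natCast, Complex.real_smul, zpow_neg,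
    zpow_natCast, ← inv_pow, inv_neg_one]
  push_cast
  field_simp

/-- The remainder after the poles `0, -1, …, -n` have been crossed; it vanishes as `n → ∞` when
`x < exp (-P)`. -/
theorem exists_norm_mellinInv_masterMellin_le {δ : ℝ} (hδ : 0 < δ) {φ : ℂ → ℂ}
    (hφ : HardyClass δ φ) :
    ∃ M P : ℝ, ∀ x : ℝ, 0 < x → ∀ n : ℕ,
      ‖mellinInv (-((n : ℝ) + 1 / 2)) (masterMellin φ) x‖ ≤
        M * (Real.exp P * x) ^ ((n : ℝ) + 1 / 2) := by
  obtain ⟨C, P, A, hC, hA0, hA, h⟩ := hφ.exists_bound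
  have hη : 0 < π - A := by linarith
  refine ⟨1 / (2 * π) * (C * (2 * π) * ∫ y : ℝ, Real.exp (-((π - A) * |y|))), P,
    fun x hx n => ?_⟩
  have hn : (0 : ℝ) ≤ n := n.cast_nonneg
  rw [mellinInv_masterMellin_eq_integral φ (-(n : ℤ) - 1) (by push_cast; linarith)
    (by push_cast; linarith), norm_smul, Real.norm_of_nonneg (by positivity), mul_assoc (1 / _)]
  gcongr
  rw [mul_right_comm, ← integral_const_mul]
  refine norm_integral_le_of_norm_le ((integrable_exp_neg_mul_abs hη).const_mul _)
    (Eventually.of_forall fun y => ?_)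
  generalize hc : -((n : ℝ) + 1 / 2) = c
  have hre : (c + y * I : ℂ).re = c := by simp
  have him : (c + y * I : ℂ).im = y := by simp
  have hcos : Real.cos (π * (c + y * I : ℂ).re) = 0 := by
    rw [hre]
    refine Real.cos_eq_zero_iff.2 ⟨-(n : ℤ) - 1, ?_⟩
    push_cast
    rw [← hc]; ring
  have h1 := h (c + y * I) (by rw [hre, ← hc]; linarith)
  have h2 := norm_pi_div_sin_le_of_cos_eq_zero hcos
  rw [hre, him] at h1
  rw [him] at h2
  rw [norm_mul, norm_mul, Complex.norm_cpow_eq_rpow_re_of_pos hx, Complex.neg_re, hre]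
  calc _ ≤ x ^ (-c) * (C * Real.exp (-(P * c)) * Real.exp (A * |y|)) *
        (2 * π * Real.exp (-(π * |y|))) := by gcongr
    _ = C * (2 * π) * (Real.exp (P * (-c)) * x ^ (-c)) *
        (Real.exp (A * |y|) * Real.exp (-(π * |y|))) := by
        rw [mul_neg]; ring
    _ = _ := by
        have hcn : (n : ℝ) + 1 / 2 = -c := by rw [← hc, neg_neg]
        rw [← Real.exp_add, hcn, Real.mul_rpow (Real.exp_pos _).le hx.le, ← Real.exp_mul]
        ring_nf

theorem eventually_mellinInv_masterMellin_eq_of_hasSum {δ : ℝ} (hδ : 0 < δ) {φ : ℂ → ℂ}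
    (hφ : HardyClass δ φ) {c : ℝ} (hc : c ∈ Ioc 0 δ) :
    ∀ᶠ x : ℝ in 𝓝[>] 0, ∀ w : ℂ,
      HasSum (fun k : ℕ => φ (k : ℂ) * (-1) ^ k / (k.factorial : ℂ) * (x : ℂ) ^ k) w →
        mellinInv c (masterMellin φ) x = w := by
  obtain ⟨M, P, hM⟩ := exists_norm_mellinInv_masterMellin_le hδ hφ
  filter_upwards [Ioo_mem_nhdsGT (Real.exp_pos (-P))] with x hx w hw
  have hxP : Real.exp P * x < 1 := by
    have := mul_lt_mul_of_pos_left hx.2 (Real.exp_pos P)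
    rwa [← Real.exp_add, add_neg_cancel, Real.exp_zero] at this
  have hxP0 : 0 < Real.exp P * x := mul_pos (Real.exp_pos P) hx.1
  -- the successive vertical lines: one to the right of `0`, then one in each gap between poles
  let l : ℕ → ℝ := fun n => Nat.casesOn n (min δ 1 / 2) fun m => -((m : ℝ) + 1 / 2)
  have hm : 0 < min δ 1 := lt_min hδ one_pos
  have hl0 : l 0 = min δ 1 / 2 := rfl
  have hlS : ∀ m : ℕ, l (m + 1) = -((m : ℝ) + 1 / 2) := fun m => rfl
  have hstep : ∀ n, mellinInv (l n) (masterMellin φ) x - mellinInv (l (n + 1)) (masterMellin φ) x =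
      φ n * (-1) ^ n / (n.factorial : ℂ) * (x : ℂ) ^ n := by
    intro n
    have hn : (0 : ℝ) ≤ n := n.cast_nonneg
    have hln : -(n : ℝ) < l n ∧ l n < -(n : ℝ) + 1 ∧ l n ≤ δ := by
      cases n with
      | zero =>
        rw [hl0]
        push_cast
        refine ⟨by linarith, by linarith [min_le_right δ 1], by linarith [min_le_left δ 1]⟩
      | succ m =>
        rw [hlS]
        push_cast
        have : (0 : ℝ) ≤ m := m.cast_nonneg
        refine ⟨by linarith, by linarith, by linarith⟩
    exact mellinInv_masterMellin_sub hφ hx.1 n (by rw [hlS]; linarith) (by rw [hlS]; linarith)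
      hln.1 hln.2.1 hln.2.2
  have hsum : ∀ n, ∑ k ∈ Finset.range n, φ (k : ℂ) * (-1) ^ k / (k.factorial : ℂ) * (x : ℂ) ^ k =
      mellinInv (l 0) (masterMellin φ) x - mellinInv (l n) (masterMellin φ) x := fun n => by
    rw [← Finset.sum_range_sub' fun n => mellinInv (l n) (masterMellin φ) x]
    exact Finset.sum_congr rfl fun k _ => (hstep k).symm
  have hlim : Tendsto (fun n : ℕ => mellinInv (l (n + 1)) (masterMellin φ) x) atTop (𝓝 0) := by
    refine squeeze_zero_norm (fun n => hM x hx.1 n) ?_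
    have h1 : Tendsto (fun n : ℕ => (Real.exp P * x) ^ ((n : ℝ) + 1 / 2)) atTop (𝓝 0) :=
      (tendsto_rpow_atTop_of_base_lt_one _ (by linarith) hxP).comp
        (tendsto_atTop_add_const_right _ _ tendsto_natCast_atTop_atTop)
    simpa using h1.const_mul M
  have h2 := (tendsto_add_atTop_iff_nat 1).2 hw.tendsto_sum_nat
  have h3 : Tendsto (fun n : ℕ => ∑ k ∈ Finset.range (n + 1),
      φ (k : ℂ) * (-1) ^ k / (k.factorial : ℂ) * (x : ℂ) ^ k) atTop
      (𝓝 (mellinInv (l 0) (masterMellin φ) x)) := by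
    simp_rw [hsum]
    simpa using tendsto_const_nhds.sub hlim
  rw [tendsto_nhds_unique h2 h3]
  exact mellinInv_masterMellin_eq hφ hx.1 hc
    ⟨by rw [hl0]; linarith, by rw [hl0]; linarith [min_le_left δ 1]⟩

/-! ### Analyticity of the inverse Mellin integral -/

lemma differentiableAt_integral_cexp_mul {g : ℝ → ℂ} (hg : Continuous g) {K η : ℝ} (hη : 0 < η)
    (hK : ∀ y, ‖g y‖ ≤ K * Real.exp (-(η * |y|))) {u : ℂ} (hu : |u.im| < η / 2) :
    DifferentiableAt ℂ (fun u : ℂ => ∫ y : ℝ, Complex.exp (-(y * I) * u) * g y) u := by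
  have hK0 : 0 ≤ K := by
    have := (norm_nonneg _).trans (hK 0)
    exact nonneg_of_mul_nonneg_left this (Real.exp_pos _)
  have hnorm : ∀ (y : ℝ) (v : ℂ), |v.im| < η / 2 →
      ‖Complex.exp (-(y * I) * v) * g y‖ ≤ K * Real.exp (-(η / 2 * |y|)) := by
    intro y v hv
    rw [norm_mul, Complex.norm_exp]
    have hre : (-(y * I) * v).re = y * v.im := by simp
    have hle : y * v.im ≤ η / 2 * |y| :=
      (le_abs_self _).trans (by rw [abs_mul, mul_comm]; gcongr)
    calc _ ≤ Real.exp (η / 2 * |y|) * (K * Real.exp (-(η * |y|))) := by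
          rw [hre]; gcongr; exact hK y
      _ = K * (Real.exp (η / 2 * |y|) * Real.exp (-(η * |y|))) := by ring
      _ = _ := by rw [← Real.exp_add]; ring_nf
  have hopen : IsOpen {v : ℂ | |v.im| < η / 2} :=
    isOpen_lt (by fun_prop) continuous_const
  refine (hasDerivAt_integral_of_dominated_loc_of_deriv_le (μ := volume)
    (s := {v : ℂ | |v.im| < η / 2}) (F := fun (u : ℂ) (y : ℝ) => Complex.exp (-(y * I) * u) * g y)
    (F' := fun (u : ℂ) (y : ℝ) => -(y * I) * (Complex.exp (-(y * I) * u) * g y))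
    (bound := fun y => K * (4 / η) * Real.exp (-(η / 4 * |y|)))
    (hopen.mem_nhds hu) (Eventually.of_forall fun v => ?_) ?_ ?_ ?_ ?_ ?_).2.differentiableAt
  · exact (by fun_prop : Continuous fun y : ℝ => Complex.exp (-(y * I) * v) * g y).aestronglyMeasurable
  · exact ((integrable_exp_neg_mul_abs (half_pos hη)).const_mul K).mono'
      (by fun_prop : Continuous fun y : ℝ => Complex.exp (-(y * I) * u) * g y).aestronglyMeasurable
      (Eventually.of_forall fun y => hnorm y u hu)
  · exact (by fun_prop : Continuous fun y : ℝ =>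
      -(y * I) * (Complex.exp (-(y * I) * u) * g y)).aestronglyMeasurable
  · refine Eventually.of_forall fun y v hv => ?_
    rw [norm_mul]
    have h1 : ‖-((y : ℂ) * I)‖ = |y| := by simp
    -- `t ≤ e ^ t` turns the factor `|y|` into half of the available exponential decay
    have h2 : |y| ≤ 4 / η * Real.exp (η / 4 * |y|) := by
      have := Real.add_one_le_exp (η / 4 * |y|)
      calc |y| = 4 / η * (η / 4 * |y|) := by field_simp
        _ ≤ _ := by gcongr; linarith
    rw [h1]
    calc _ ≤ 4 / η * Real.exp (η / 4 * |y|) * (K * Real.exp (-(η / 2 * |y|))) := by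
          gcongr; exact hnorm y v hv
      _ = K * (4 / η) * (Real.exp (η / 4 * |y|) * Real.exp (-(η / 2 * |y|))) := by ring
      _ = _ := by rw [← Real.exp_add]; ring_nf
  · exact (integrable_exp_neg_mul_abs (by linarith)).const_mul _
  · refine Eventually.of_forall fun y v _ => ?_
    have h := (((hasDerivAt_id v).const_mul (-(y * I : ℂ))).cexp).mul_const (g y)
    convert! h using 1
    simp only [id]; ring

/-- In the variable `u = log x` the inverse Mellin integral is a bilateral Laplace integral, which
converges in a complex neighbourhood of the real line. -/
theorem analyticOnNhd_mellinInv {F : ℂ → ℂ} {c : ℝ} (hF : Continuous fun y : ℝ => F (c + y * I))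
    {K η : ℝ} (hη : 0 < η) (hK : ∀ y : ℝ, ‖F (c + y * I)‖ ≤ K * Real.exp (-(η * |y|))) :
    AnalyticOnNhd ℝ (mellinInv c F) (Ioi 0) := by
  let L : ℂ → ℂ := fun u => (1 / (2 * π) : ℝ) • (Complex.exp (-c * u) *
    ∫ y : ℝ, Complex.exp (-(y * I) * u) * F (c + y * I))
  have hopen : IsOpen {v : ℂ | |v.im| < η / 2} :=
    isOpen_lt (by fun_prop) continuous_const
  have hL : DifferentiableOn ℂ L {v : ℂ | |v.im| < η / 2} := fun v hv =>
    (((by fun_prop : DifferentiableAt ℂ (fun u : ℂ => Complex.exp (-c * u)) v).mul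
      (differentiableAt_integral_cexp_mul hF hη hK hv)).const_smul
        (1 / (2 * π) : ℝ)).differentiableWithinAt
  have heq : EqOn (fun x : ℝ => L (Real.log x : ℝ)) (mellinInv c F) (Ioi 0) := by
    intro x hx
    simp only [L, mellinInv]
    rw [← integral_const_mul]
    congr 2
    ext y
    rw [Complex.cpow_def_of_ne_zero (Complex.ofReal_ne_zero.2 (ne_of_gt hx)), smul_eq_mul,
      ← mul_assoc, ← Complex.exp_add, Complex.ofReal_log (le_of_lt hx)]
    ring_nf
  refine AnalyticOnNhd.congr isOpen_Ioi (fun x hx => ?_) heq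
  have h1 : AnalyticAt ℝ L ((Real.log x : ℝ) : ℂ) :=
    ((hL.analyticOnNhd hopen) _ (by simpa using hη)).restrictScalars
  have h2 : AnalyticAt ℝ (fun x : ℝ => ((Real.log x : ℝ) : ℂ)) x :=
    (Complex.ofRealCLM.analyticAt _).comp (analyticAt_log hx)
  exact AnalyticAt.fun_comp h1 h2

/-! ### Ramanujan's Master Theorem -/

lemma HardyClass.continuous_masterMellin_vertical {δ : ℝ} {φ : ℂ → ℂ} (hφ : HardyClass δ φ)
    {c : ℝ} (hc : c ∈ Ioc 0 δ) : Continuous fun y : ℝ => masterMellin φ (c + y * I) :=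
  continuous_comp_vertical (a := c) (b := c) (fun _ hz =>
    (hφ.differentiableAt_masterMellin (hc.1.trans_le hz.1)
      (hz.2.trans hc.2)).continuousAt.continuousWithinAt) le_rfl le_rfl

lemma HardyClass.exists_masterMellin_vertical_le {δ : ℝ} {φ : ℂ → ℂ} (hφ : HardyClass δ φ)
    {c : ℝ} (hc : c ∈ Ioc 0 δ) :
    ∃ K η : ℝ, 0 < η ∧ ∀ y : ℝ, ‖masterMellin φ (c + y * I)‖ ≤ K * Real.exp (-(η * |y|)) := by
  obtain ⟨K, η, hη, h⟩ := exists_masterMellin_decay hφ one_pos c c hc.2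
  obtain ⟨K', -, hK'⟩ := exists_forall_norm_le_exp_neg_mul_abs
    (hφ.continuous_masterMellin_vertical hc) (K := K) (η := η)
    fun y hy => by simpa using h (c + y * I) (by simp) (by simp) (by simpa)
  exact ⟨K', η, hη, hK'⟩

lemma HardyClass.verticalIntegrable_masterMellin {δ : ℝ} {φ : ℂ → ℂ} (hφ : HardyClass δ φ)
    {c : ℝ} (hc : c ∈ Ioc 0 δ) : Complex.VerticalIntegrable (masterMellin φ) c := by
  obtain ⟨K, η, hη, h⟩ := hφ.exists_masterMellin_vertical_le hc
  exact integrable_of_exp_decay (hφ.continuous_masterMellin_vertical hc) hη fun y _ => h y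

theorem IsMasterSeries.eq_mellinInv {δ : ℝ} (hδ : 0 < δ) {φ : ℂ → ℂ} (hφ : HardyClass δ φ)
    {f : ℝ → ℂ} (hf : IsMasterSeries φ f) {c : ℝ} (hc : c ∈ Ioc 0 δ) :
    EqOn f (mellinInv c (masterMellin φ)) (Ioi 0) := by
  obtain ⟨K, η, hη, hK⟩ := hφ.exists_masterMellin_vertical_le hc
  have hev : f =ᶠ[𝓝[>] 0] mellinInv c (masterMellin φ) := by
    filter_upwards [hf.2, eventually_mellinInv_masterMellin_eq_of_hasSum hδ hφ hc] with x h1 h2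
    exact (h2 _ h1).symm
  obtain ⟨ε, hε, hsub⟩ := mem_nhdsGT_iff_exists_Ioo_subset.1 hev
  have hε : 0 < ε := hε
  exact hf.1.eqOn_of_preconnected_of_eventuallyEq
    (analyticOnNhd_mellinInv (hφ.continuous_masterMellin_vertical hc) hη hK)
    isPreconnected_Ioi (z₀ := ε / 2) (half_pos hε)
    (mem_of_superset (Ioo_mem_nhds (half_pos hε) (half_lt_self hε)) hsub)

lemma exists_norm_mellinInv_le (F : ℂ → ℂ) (c : ℝ) :
    ∃ M : ℝ, ∀ x : ℝ, 0 < x → ‖mellinInv c F x‖ ≤ M * x ^ (-c) := by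
  refine ⟨1 / (2 * π) * ∫ y : ℝ, ‖F (c + y * I)‖, fun x hx => ?_⟩
  rw [mellinInv, norm_smul, Real.norm_of_nonneg (by positivity), mul_assoc]
  gcongr
  refine (norm_integral_le_integral_norm _).trans_eq ?_
  rw [← integral_mul_const]
  congr 1
  ext y
  rw [norm_smul, Complex.norm_cpow_eq_rpow_re_of_pos hx, mul_comm]
  simp

theorem IsMasterSeries.exists_norm_le {δ : ℝ} (hδ : 0 < δ) {φ : ℂ → ℂ} (hφ : HardyClass δ φ)
    {f : ℝ → ℂ} (hf : IsMasterSeries φ f) {c : ℝ} (hc : c ∈ Ioc 0 δ) :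
    ∃ M : ℝ, ∀ x : ℝ, 0 < x → ‖f x‖ ≤ M * x ^ (-c) := by
  obtain ⟨M, hM⟩ := exists_norm_mellinInv_le (masterMellin φ) c
  exact ⟨M, fun x hx => by rw [hf.eq_mellinInv hδ hφ hc hx]; exact hM x hx⟩

lemma isBigO_rpow_of_forall_norm_le {f : ℝ → ℂ} {M c : ℝ}
    (h : ∀ x : ℝ, 0 < x → ‖f x‖ ≤ M * x ^ (-c)) {l : Filter ℝ} (hl : ∀ᶠ x in l, 0 < x) :
    f =O[l] fun x => x ^ (-c) :=
  Asymptotics.IsBigO.of_bound M <| hl.mono fun x hx => by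
    rw [Real.norm_of_nonneg (Real.rpow_nonneg hx.le _)]
    exact h x hx

/-- **Ramanujan's Master Theorem** for the Hardy class, at real exponents.  With `g` the function
`Γ(z) φ(-z)` on the line `Re z = s`, the inverse Fourier transform of `g` is `e ^ (-s u) f(e ^ (-u))`,
integrable by the bounds `f(x) = O(x ^ (-c))` for `c = s / 2` and `c = δ`; Fourier inversion then
recovers `g` as the Mellin transform of `f`. -/
theorem IsMasterSeries.hasMellin {δ : ℝ} {φ : ℂ → ℂ} (hφ : HardyClass δ φ)
    {f : ℝ → ℂ} (hf : IsMasterSeries φ f) {s : ℝ} (hs : 0 < s) (hsδ : s < δ) :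
    HasMellin f s (masterMellin φ s) := by
  have hδ : 0 < δ := hs.trans hsδ
  obtain ⟨M₁, h₁⟩ := hf.exists_norm_le hδ hφ (c := s / 2) ⟨by linarith, by linarith⟩
  obtain ⟨M₂, h₂⟩ := hf.exists_norm_le hδ hφ (c := δ) ⟨hδ, le_rfl⟩
  have hsm : s ∈ Ioc 0 δ := ⟨hs, hsδ.le⟩
  refine ⟨mellinConvergent_of_isBigO_rpow (a := δ) (b := s / 2)
    (hf.1.continuousOn.locallyIntegrableOn measurableSet_Ioi)
    (isBigO_rpow_of_forall_norm_le h₂ (eventually_gt_atTop 0)) (by simpa)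
    (isBigO_rpow_of_forall_norm_le h₁ self_mem_nhdsWithin) (by simpa), ?_⟩
  let g : ℝ → ℂ := fun y => masterMellin φ (s + 2 * π * y * I)
  have hcomp : ∀ y : ℝ, g y = masterMellin φ (s + ((2 * π * y : ℝ) : ℂ) * I) := fun y => by
    simp only [g]; push_cast; rfl
  have hg : Continuous g := by
    simp_rw [funext hcomp]
    exact (hφ.continuous_masterMellin_vertical hsm).comp (by fun_prop : Continuous fun y : ℝ =>
      2 * π * y)
  have hgi : Integrable g := by
    simp_rw [funext hcomp]
    exact (hφ.verticalIntegrable_masterMellin hsm).comp_mul_left' (by positivity)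
  have hinv : (fun u : ℝ => Real.exp (-(s : ℂ).re * u) • f (Real.exp (-u))) =
      FourierTransformInv.fourierInv g := by
    ext u
    rw [hf.eq_mellinInv hδ hφ hsm (Real.exp_pos _), mellinInv_eq_fourierInv s _ (Real.exp_pos _),
      Real.log_exp, neg_neg, Complex.real_smul, smul_eq_mul, ← mul_assoc,
      Complex.cpow_def_of_ne_zero (Complex.ofReal_ne_zero.2 (Real.exp_ne_zero _)),
      ← Complex.ofReal_log (Real.exp_pos _).le, Real.log_exp, Complex.ofReal_exp,
      ← Complex.exp_add]
    convert one_mul _ using 2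
    rw [← Complex.exp_zero]
    congr 1
    simp only [Complex.ofReal_re]
    push_cast
    ring
  have hη : 0 < min (s / 2) (δ - s) := lt_min (by linarith) (by linarith)
  have hinvi : Integrable (FourierTransformInv.fourierInv g) := by
    rw [← hinv]
    refine ((integrable_exp_neg_mul_abs hη).const_mul (max M₁ M₂)).mono'
      (Continuous.aestronglyMeasurable ?_) (Eventually.of_forall fun u => ?_)
    · have : Continuous fun u : ℝ => f (Real.exp (-u)) :=
        hf.1.continuousOn.comp_continuous (by fun_prop) fun u => Real.exp_pos _
      exact (by fun_prop : Continuous fun u : ℝ => Real.exp (-(s : ℂ).re * u)).smul this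
    · have hb : ∀ {M c : ℝ}, (∀ x : ℝ, 0 < x → ‖f x‖ ≤ M * x ^ (-c)) →
          ‖Real.exp (-(s : ℂ).re * u) • f (Real.exp (-u))‖ ≤ M * Real.exp ((c - s) * u) := by
        intro M c h
        rw [norm_smul, Real.norm_of_nonneg (Real.exp_pos _).le]
        calc _ ≤ Real.exp (-(s : ℂ).re * u) * (M * Real.exp (-u) ^ (-c)) := by
              gcongr; exact h _ (Real.exp_pos _)
          _ = M * (Real.exp (-s * u) * Real.exp (-u * -c)) := by
              rw [← Real.exp_mul, Complex.ofReal_re]; ring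
          _ = _ := by rw [← Real.exp_add]; ring_nf
      have hM : 0 ≤ M₁ ∧ 0 ≤ M₂ := by
        constructor
        · simpa using (norm_nonneg _).trans (h₁ 1 one_pos)
        · simpa using (norm_nonneg _).trans (h₂ 1 one_pos)
      rcases le_total 0 u with hu | hu
      · refine (hb h₁).trans ?_
        rw [abs_of_nonneg hu]
        refine mul_le_mul (le_max_left _ _) (Real.exp_le_exp.2 ?_) (Real.exp_pos _).le
          (hM.1.trans (le_max_left _ _))
        nlinarith [min_le_left (s / 2) (δ - s)]
      · refine (hb h₂).trans ?_
        rw [abs_of_nonpos hu]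
        refine mul_le_mul (le_max_right _ _) (Real.exp_le_exp.2 ?_) (Real.exp_pos _).le
          (hM.1.trans (le_max_left _ _))
        nlinarith [min_le_right (s / 2) (δ - s)]
  have hfi : Integrable (FourierTransform.fourier g) := by
    have h := hinvi.comp_neg
    refine h.congr (Eventually.of_forall fun y => ?_)
    simp [Real.fourierInv_eq_fourier_neg]
  rw [mellin_eq_fourier, hinv, hg.fourier_fourierInv_eq hgi hfi]
  simp [g]

/-! ### The improper integral of `sin ^ n t / t ^ s` -/

lemma exists_bounded_primitive_sin_pow {n : ℕ} (hn : Odd n) :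
    ∃ (F : ℝ → ℝ) (M : ℝ), (∀ t, HasDerivAt F (Real.sin t ^ n) t) ∧ ∀ t, |F t| ≤ M := by
  obtain ⟨m, rfl⟩ := hn
  -- `sin ^ (2m+1) t dt = -(1 - v ^ 2) ^ m dv` with `v = cos t`, so there is a primitive that is a
  -- continuous function of `cos t`
  let Q : ℝ → ℝ := fun u => ∫ v in (0 : ℝ)..u, (1 - v ^ 2) ^ m
  have hc : Continuous fun v : ℝ => (1 - v ^ 2) ^ m := by fun_prop
  have hQ : ∀ u, HasDerivAt Q ((1 - u ^ 2) ^ m) u := fun u =>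
    intervalIntegral.integral_hasDerivAt_right (hc.intervalIntegrable _ _)
      (hc.stronglyMeasurableAtFilter _ _) hc.continuousAt
  have hQc : Continuous Q := continuous_iff_continuousAt.2 fun u => (hQ u).continuousAt
  obtain ⟨M, hM⟩ := (isCompact_Icc (a := (-1 : ℝ)) (b := 1)).exists_bound_of_continuousOn
    hQc.continuousOn
  refine ⟨fun t => -Q (Real.cos t), M, fun t => ?_, fun t => ?_⟩
  · have h := ((hQ (Real.cos t)).comp t (Real.hasDerivAt_cos t)).neg
    convert! h using 1
    rw [pow_succ, pow_mul, Real.sin_sq]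
    ring
  · rw [abs_neg]
    exact hM _ ⟨Real.neg_one_le_cos t, Real.cos_le_one t⟩

lemma intervalIntegrable_sin_pow_div_rpow (n : ℕ) (s : ℝ) {a b : ℝ} (ha : 0 < a) (hb : 0 < b) :
    IntervalIntegrable (fun t : ℝ => Real.sin t ^ n / t ^ s) volume a b := by
  have h : ∀ t ∈ uIcc a b, 0 < t := fun t ht => (lt_min ha hb).trans_le ht.1
  refine ContinuousOn.intervalIntegrable (ContinuousOn.div (by fun_prop) ?_ fun t ht =>
    (Real.rpow_pos_of_pos (h t ht) s).ne')
  exact continuousOn_id.rpow_const fun t ht => Or.inl (h t ht).ne'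

lemma integrableOn_sin_pow_div_rpow_Ioc {n : ℕ} {s : ℝ} (hsn : s < (n : ℝ) + 1) :
    IntegrableOn (fun t : ℝ => Real.sin t ^ n / t ^ s) (Ioc 0 1) := by
  have h : IntegrableOn (fun t : ℝ => t ^ ((n : ℝ) - s)) (Ioc 0 1) :=
    (intervalIntegrable_iff_integrableOn_Ioc_of_le zero_le_one).1
      (intervalIntegral.intervalIntegrable_rpow' (by linarith))
  refine h.mono' (Measurable.aestronglyMeasurable (by fun_prop)) ?_
  refine (ae_restrict_mem measurableSet_Ioc).mono fun t ht => ?_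
  rw [norm_div, norm_pow, Real.norm_of_nonneg (Real.rpow_nonneg ht.1.le s),
    Real.rpow_sub ht.1, Real.rpow_natCast]
  have := Real.rpow_nonneg ht.1.le s
  gcongr
  exact (Real.abs_sin_le_abs).trans_eq (abs_of_pos ht.1)

lemma exists_tendsto_integral_sin_pow_div_rpow_of_one_lt (n : ℕ) {s : ℝ} (hs : 1 < s) :
    ∃ L : ℝ, Tendsto (fun b : ℝ => ∫ t in (1 : ℝ)..b, Real.sin t ^ n / t ^ s) atTop (𝓝 L) := by
  have h : IntegrableOn (fun t : ℝ => t ^ (-s)) (Ioi 1) :=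
    integrableOn_Ioi_rpow_of_lt (by linarith) one_pos
  refine ⟨_, intervalIntegral_tendsto_integral_Ioi 1 (h.mono'
    (Measurable.aestronglyMeasurable (by fun_prop)) ?_) tendsto_id⟩
  refine (ae_restrict_mem measurableSet_Ioi).mono fun t ht => ?_
  have ht0 : 0 < t := one_pos.trans ht
  rw [norm_div, norm_pow, Real.norm_of_nonneg (Real.rpow_nonneg ht0.le s),
    Real.rpow_neg ht0.le, ← one_div]
  have := Real.rpow_nonneg ht0.le s
  gcongr
  exact pow_le_one₀ (norm_nonneg _) (Real.abs_sin_le_one t)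

lemma exists_tendsto_integral_sin_pow_div_rpow_of_odd {n : ℕ} (hn : Odd n) {s : ℝ} (hs : 0 < s) :
    ∃ L : ℝ, Tendsto (fun b : ℝ => ∫ t in (1 : ℝ)..b, Real.sin t ^ n / t ^ s) atTop (𝓝 L) := by
  obtain ⟨F, M, hF, hM⟩ := exists_bounded_primitive_sin_pow hn
  have hFc : Continuous F := continuous_iff_continuousAt.2 fun t => (hF t).continuousAt
  have hi : IntegrableOn (fun t : ℝ => -s * t ^ (-s - 1) * F t) (Ioi 1) := by
    have h : IntegrableOn (fun t : ℝ => s * M * t ^ (-s - 1)) (Ioi 1) :=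
      (integrableOn_Ioi_rpow_of_lt (by linarith) one_pos).const_mul _
    refine h.mono' (Measurable.aestronglyMeasurable (by fun_prop)) ?_
    refine (ae_restrict_mem measurableSet_Ioi).mono fun t ht => ?_
    have ht0 : 0 < t := one_pos.trans ht
    have := Real.rpow_nonneg ht0.le (-s - 1)
    rw [norm_mul, norm_mul, norm_neg, Real.norm_of_nonneg hs.le, Real.norm_of_nonneg this,
      mul_right_comm s]
    gcongr
    exact hM t
  have hlim := intervalIntegral_tendsto_integral_Ioi 1 hi tendsto_id
  have hbd : Tendsto (fun b : ℝ => b ^ (-s) * F b) atTop (𝓝 0) :=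
    (tendsto_rpow_neg_atTop hs).zero_mul_isBoundedUnder_le
      (isBoundedUnder_of ⟨M, hM⟩)
  refine ⟨_, ((hbd.sub_const ((1 : ℝ) ^ (-s) * F 1)).sub hlim).congr' ?_⟩
  filter_upwards [eventually_ge_atTop 1] with b hb
  have h0 : ∀ t ∈ uIcc 1 b, 0 < t := fun t ht => by
    rw [uIcc_of_le hb] at ht; exact one_pos.trans_le ht.1
  have hparts := intervalIntegral.integral_mul_deriv_eq_deriv_mul (a := 1) (b := b)
    (u := fun t : ℝ => t ^ (-s)) (u' := fun t : ℝ => -s * t ^ (-s - 1)) (v := F)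
    (v' := fun t => Real.sin t ^ n)
    (fun t ht => Real.hasDerivAt_rpow_const (Or.inl (h0 t ht).ne')) (fun t _ => hF t)
    (ContinuousOn.intervalIntegrable (continuousOn_const.mul
      (continuousOn_id.rpow_const fun t ht => Or.inl (h0 t ht).ne')))
    (Continuous.intervalIntegrable (by fun_prop) _ _)
  rw [id, ← hparts]
  refine intervalIntegral.integral_congr fun t ht => ?_
  rw [Real.rpow_neg (h0 t ht).le, div_eq_mul_inv, mul_comm]

theorem exists_hasImproperIntegral_sin_pow_div_rpow {n : ℕ} {s : ℝ} (hs0 : 0 < s)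
    (hsn : s < (n : ℝ) + 1) (hconv : 1 < s ∨ Odd n) :
    ∃ L : ℝ, HasImproperIntegral (fun t : ℝ => Real.sin t ^ n / t ^ s) L := by
  obtain ⟨L, hL⟩ : ∃ L : ℝ, Tendsto (fun b : ℝ => ∫ t in (1 : ℝ)..b, Real.sin t ^ n / t ^ s)
      atTop (𝓝 L) := by
    rcases hconv with h | h
    · exact exists_tendsto_integral_sin_pow_div_rpow_of_one_lt n h
    · exact exists_tendsto_integral_sin_pow_div_rpow_of_odd h hs0
  have h0 : Tendsto (fun a : ℝ => ∫ t in a..1, Real.sin t ^ n / t ^ s) (𝓝[>] 0)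
      (𝓝 (∫ t in (0 : ℝ)..1, Real.sin t ^ n / t ^ s)) := by
    have h := intervalIntegral.continuousOn_primitive_interval_left (a := 0) (b := 1)
      (f := fun t : ℝ => Real.sin t ^ n / t ^ s) (μ := volume) (by
        rw [uIcc_of_le zero_le_one, integrableOn_Icc_iff_integrableOn_Ioc]
        exact integrableOn_sin_pow_div_rpow_Ioc hsn)
    have h1 := h 0 left_mem_uIcc
    rw [uIcc_of_le zero_le_one] at h1
    exact (h1.mono_of_mem_nhdsWithin (Icc_mem_nhdsGT one_pos)).tendsto
  refine ⟨_, fun a b ha hab => intervalIntegrable_sin_pow_div_rpow n s ha (ha.trans_le hab),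
    ((h0.comp tendsto_fst).add (hL.comp tendsto_snd)).congr' ?_⟩
  have h1 : ∀ᶠ p : ℝ × ℝ in 𝓝[>] (0 : ℝ) ×ˢ atTop, 0 < p.1 ∧ 0 < p.2 :=
    (eventually_mem_nhdsWithin.prod_inl _).and ((eventually_gt_atTop 0).prod_inr _)
  filter_upwards [h1] with p hp
  exact intervalIntegral.integral_add_adjacent_intervals
    (intervalIntegrable_sin_pow_div_rpow n s hp.1 one_pos)
    (intervalIntegrable_sin_pow_div_rpow n s one_pos hp.2)

lemma HasImproperIntegral.const_mul_ofReal {g : ℝ → ℝ} {L : ℝ} (h : HasImproperIntegral g L)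
    (c : ℂ) {G : ℝ → ℂ} (hG : ∀ t : ℝ, 0 < t → G t = c * (g t : ℂ)) :
    HasImproperIntegral G (c * (L : ℂ)) := by
  have hpos : ∀ {a b : ℝ}, 0 < a → 0 < b → EqOn (fun t => c * (g t : ℂ)) G (uIcc a b) :=
    fun ha hb t ht => (hG t ((lt_min ha hb).trans_le ht.1)).symm
  refine ⟨fun a b ha hab => ?_, ?_⟩
  · have hi : IntervalIntegrable (fun t => c * (g t : ℂ)) volume a b :=
      IntervalIntegrable.const_mul
        ⟨(h.1 a b ha hab).1.ofReal, (h.1 a b ha hab).2.ofReal⟩ c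
    exact hi.congr ((hpos ha (ha.trans_le hab)).mono uIoc_subset_uIcc)
  · have hlim : Tendsto (fun p : ℝ × ℝ => c * ((∫ t in p.1..p.2, g t : ℝ) : ℂ))
        (𝓝[>] (0 : ℝ) ×ˢ atTop) (𝓝 (c * (L : ℂ))) :=
      ((Complex.continuous_ofReal.tendsto L).comp h.2).const_mul c
    refine hlim.congr' ?_
    have h1 : ∀ᶠ p : ℝ × ℝ in 𝓝[>] (0 : ℝ) ×ˢ atTop, 0 < p.1 ∧ 0 < p.2 :=
      (eventually_mem_nhdsWithin.prod_inl _).and ((eventually_gt_atTop 0).prod_inr _)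
    filter_upwards [h1] with p hp
    rw [← intervalIntegral.integral_congr (hpos hp.1 hp.2), intervalIntegral.integral_const_mul,
      intervalIntegral.integral_ofReal]

/-! ### The iterated integral -/

theorem theorem5p1 (n : ℕ) (s : ℝ) (hs0 : 0 < s) (hsn : s < (n : ℝ) + 1)
    (hconv : 1 < s ∨ Odd n)
    (δ : ℝ) (hδ : s < δ) (φ : ℂ → ℂ) (hφ : HardyClass δ φ)
    (f : ℝ → ℂ) (hf : IsMasterSeries φ f) :
    (∀ t : ℝ, 0 < t →
      IntegrableOn
        (fun x : ℝ => ((x ^ (s - 1) * Real.sin t ^ n : ℝ) : ℂ) * f (x * t)) (Ioi 0)) ∧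
    ∃ L : ℝ,
      HasImproperIntegral (fun t : ℝ => Real.sin t ^ n / t ^ s) L ∧
      HasImproperIntegral
        (fun t : ℝ => ∫ x in Ioi (0 : ℝ),
          ((x ^ (s - 1) * Real.sin t ^ n : ℝ) : ℂ) * f (x * t))
        ((Real.Gamma s : ℂ) * φ (-(s : ℂ)) * (L : ℂ)) := by
  obtain ⟨hconvf, hmellin⟩ := hf.hasMellin hφ hs0 hδ
  have hcongr : ∀ t : ℝ, EqOn
      (fun x : ℝ => (Real.sin t : ℂ) ^ n * ((x : ℂ) ^ ((s : ℂ) - 1) • f (x * t)))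
      (fun x : ℝ => ((x ^ (s - 1) * Real.sin t ^ n : ℝ) : ℂ) * f (x * t)) (Ioi 0) := by
    intro t x hx
    simp only [smul_eq_mul, Complex.ofReal_mul, Complex.ofReal_pow]
    rw [Complex.ofReal_cpow (le_of_lt hx)]
    push_cast
    ring
  have hmc : ∀ t : ℝ, 0 < t → MellinConvergent (fun x => f (x * t)) s := fun t ht => by
    simpa only [mul_comm] using (MellinConvergent.comp_mul_left (f := f) (s := s) ht).2 hconvf
  obtain ⟨L, hL⟩ := exists_hasImproperIntegral_sin_pow_div_rpow hs0 hsn hconv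
  refine ⟨fun t ht => ?_, L, hL, hL.const_mul_ofReal _ fun t ht => ?_⟩
  · exact IntegrableOn.congr_fun (Integrable.const_mul (hmc t ht) _) (hcongr t) measurableSet_Ioi
  · have h := mellin_comp_mul_right f s ht
    rw [hmellin, mellin] at h
    rw [← setIntegral_congr_fun measurableSet_Ioi (hcongr t), integral_const_mul, h,
      masterMellin, Complex.Gamma_ofReal, smul_eq_mul, Complex.cpow_neg, div_eq_mul_inv,
      Complex.ofReal_mul, Complex.ofReal_inv, Complex.ofReal_cpow ht.le, Complex.ofReal_pow]
    ring
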